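/- Let $X$ be a standard Gaussian random variable with distribution $\gamma=N(0,1)$ on $\mathbb R$. For a random variable $Y$ let $P_Y$ be its distribution, and for a finite signed measure $\mu$ on $\mathbb R$ let $\|\mu\|_{\mathrm{var}}=\sup\sum_i|\mu(A_i)|$, the supremum being over all finite measurable partitions $(A_i)$ of $\mathbb R$. Let $m\ge 1$ be an integer. (i) For every real polynomial $f$ of degree $m$ in one variable there is a constant $C_f>0$ such that $$\|P_{f(X)}-P_{f(X)+u}\|_{\mathrm{var}}\le C_f\,|u|^{1/m}\qquad\text{for all } u\in\mathbb R .$$ (ii) For non-constant real polynomials $f,g$ of degree at most $m$ in one variable put $\Delta(f,g)=\|P_{f(X)}-P_{g(X)}\|_{\mathrm{var}}$, $\delta(f,g)=\max_{0\le k\le m}|a_k-b_k|$, where $f(x)=\sum_{k=0}^m a_kx^{m-k}$ and $g(x)=\sum_{k=0}^m b_kx^{m-k}$, and $\|\nabla f\|_\star=\big(\mathbb E|f'(X)|^2\big)^{1/2}$. Then $$\Delta(f,g)\le C\,\delta(f,g)^{1/(m+1)},$$ where the constant $C>0$ depends only on $m$, $\|\nabla f\|_\star$ and $\|\nabla g\|_\star$.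 -/

import Mathlib

open MeasureTheory ProbabilityTheory Polynomial

namespace ImageTV

noncomputable section

/-- The standard Gaussian distribution on the real line, i.e. the law of `X`. -/
abbrev stdGauss : Measure ℝ := gaussianReal 0 1

/-- The total variation norm `‖μ - ν‖_var` of the difference of two finite measures: the supremum
of `∑ i, |μ (A i) - ν (A i)|` over finite measurable partitions of the space (so that it is at
most `2` for probability measures). -/
def tvDist {S : Type*} [MeasurableSpace S] (μ ν : Measure S) [IsFiniteMeasure μ]
    [IsFiniteMeasure ν] : ℝ :=
  (VectorMeasure.variation (μ.toSignedMeasure - ν.toSignedMeasure)).real Set.univ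

/-- The variation in `tvDist` agrees with the one from the Jordan decomposition;
in particular it is finite. -/
theorem tvDist_eq_totalVariation {S : Type*} [MeasurableSpace S] (μ ν : Measure S)
    [IsFiniteMeasure μ] [IsFiniteMeasure ν] :
    tvDist μ ν = ((μ.toSignedMeasure - ν.toSignedMeasure).totalVariation).real Set.univ := by
  rw [tvDist, SignedMeasure.totalVariation_eq_variation]

theorem variation_ne_top {S : Type*} [MeasurableSpace S] (μ ν : Measure S)
    [IsFiniteMeasure μ] [IsFiniteMeasure ν] :
    VectorMeasure.variation (μ.toSignedMeasure - ν.toSignedMeasure) Set.univ ≠ ⊤ := by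
  rw [← SignedMeasure.totalVariation_eq_variation]
  exact measure_ne_top _ _

/-- `‖P_{f(X)} - P_{g(X)}‖_var` for a random variable `X` with distribution `Q`: the law of `f(X)`
is the image of `Q` under `f`. -/
def imageDist (Q : Measure ℝ) [IsFiniteMeasure Q] (f g : ℝ → ℝ) : ℝ :=
  tvDist (Q.map f) (Q.map g)

/-- The condition `‖P_{f(X)} - P_{f(X)+u}‖_var ≤ C |u| ^ α` for all real `u`, where `X` has
distribution `Q`. -/
def ShiftCondition (Q : Measure ℝ) [IsFiniteMeasure Q] (f : ℝ → ℝ) (α C : ℝ) : Prop :=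
  ∀ u : ℝ, imageDist Q f (fun x => f x + u) ≤ C * |u| ^ α

/-- `‖∇f‖_⋆ = (E |f'(X)|²)^{1/2}` for a polynomial in one standard Gaussian variable
(in dimension one the only unit directions are `±1`). -/
def gradNorm (f : ℝ[X]) : ℝ :=
  Real.sqrt (∫ x, (f.derivative.eval x) ^ 2 ∂stdGauss)

/-- The maximal difference of the coefficients of `x ^ k`, `0 ≤ k ≤ m`, of two polynomials. -/
def coeffDist (m : ℕ) (f g : ℝ[X]) : ℝ :=
  (Finset.range (m + 1)).sup' Finset.nonempty_range_add_one (fun k => |f.coeff k - g.coeff k|)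

end

end ImageTV

/-!
Integration by parts against the Gaussian density bounds `E Φ'(f(X))` by a multiple of
`‖Φ‖_∞ ^ (1 / m) * ‖Φ'‖_∞ ^ (1 - 1 / m)`. It requires dividing by `p = f'`, and `1 / p` is replaced
by `p / (p ^ 2 + τ ^ 2)`. The price is twofold. The variation of the new factor on the line is
controlled by that of the argument of `p - iτ`, hence by `deg p * π / τ`, since each complex root
contributes at most `π`. The error `E[τ ^ 2 / (p(X) ^ 2 + τ ^ 2)]` is of order `τ ^ (1 / (m - 1))`
(if `m > 1`; otherwise `p` is constant), because `p(x)` can be small compared with the Mahler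
measure of `p` only if `x` is close to a root. It remains to optimize over `τ`.

Applied to `Φ(y) = F(y) - F(y + u)` with `F' = φ` and `|φ| ≤ 1`, the estimate gives (i). For (ii), a
test function `φ` is split into its average over intervals of length `ε`, which is Lipschitz and
sees only `E|f(X) - g(X)| / ε`, and a remainder whose primitive is bounded by `ε`.
-/

namespace ImageTV

section TotalVariation

variable {S : Type*} [MeasurableSpace S]

theorem exists_measurable_abs_le_one_tvDist_eq (μ ν : Measure S) [IsFiniteMeasure μ]
    [IsFiniteMeasure ν] :
    ∃ s : S → ℝ, Measurable s ∧ (∀ x, |s x| ≤ 1) ∧ tvDist μ ν = ∫ x, s x ∂μ - ∫ x, s x ∂ν := by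
  obtain ⟨A, hA, _, _, hpos, hneg⟩ :=
    (μ.toSignedMeasure - ν.toSignedMeasure).toJordanDecomposition_spec
  have integrable_indicator (ρ : Measure S) [IsFiniteMeasure ρ] {D : Set S}
      (hD : MeasurableSet D) : Integrable (D.indicator (1 : S → ℝ)) ρ :=
    (integrable_const (1 : ℝ)).indicator hD
  have integral_sign (ρ : Measure S) [IsFiniteMeasure ρ] :
      ∫ x, (A.indicator 1 x - Aᶜ.indicator 1 x : ℝ) ∂ρ = ρ.real A - ρ.real Aᶜ := by
    rw [integral_sub (integrable_indicator ρ hA) (integrable_indicator ρ hA.compl),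
      integral_indicator_one hA, integral_indicator_one hA.compl]
  refine ⟨fun x => A.indicator 1 x - Aᶜ.indicator 1 x,
    (measurable_one.indicator hA).sub (measurable_one.indicator hA.compl), fun x => ?_, ?_⟩
  · by_cases hx : x ∈ A <;> simp [hx]
  · rw [integral_sign, integral_sign, tvDist_eq_totalVariation, SignedMeasure.totalVariation,
      measureReal_add_apply, hpos, hneg,
      SignedMeasure.toMeasureOfZeroLE_real_apply _ _ _ MeasurableSet.univ,
      SignedMeasure.toMeasureOfLEZero_real_apply _ _ _ MeasurableSet.univ, Set.inter_univ,
      Set.inter_univ, Measure.toSignedMeasure_sub_apply hA,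
      Measure.toSignedMeasure_sub_apply hA.compl]
    ring

theorem tvDist_self (μ : Measure S) [IsFiniteMeasure μ] : tvDist μ μ = 0 := by
  obtain ⟨s, -, -, h⟩ := exists_measurable_abs_le_one_tvDist_eq μ μ
  rw [h, sub_self]

variable [TopologicalSpace S] [BorelSpace S]

theorem exists_continuous_abs_le_one_integral_abs_sub_le [NormalSpace S] {ρ : Measure S}
    [ρ.WeaklyRegular] [IsFiniteMeasure ρ] {s : S → ℝ} (hs : Integrable s ρ)
    (hs_le : ∀ x, |s x| ≤ 1) {ε : ℝ} (hε : 0 < ε) :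
    ∃ φ : S → ℝ, Continuous φ ∧ (∀ x, |φ x| ≤ 1) ∧ ∫ x, |s x - φ x| ∂ρ ≤ ε := by
  obtain ⟨g, hg, hg_int⟩ := hs.exists_boundedContinuous_integral_sub_le hε
  set φ : S → ℝ := fun x => max (-1) (min 1 (g x))
  have hφ_cont : Continuous φ := by fun_prop
  have hφ_le (x : S) : |φ x| ≤ 1 :=
    abs_le.2 ⟨le_max_left _ _, max_le (by norm_num) (min_le_left _ _)⟩
  have clip_le (x : S) : |s x - φ x| ≤ |s x - g x| := by
    have hsx := abs_le.1 (hs_le x)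
    calc |s x - φ x| = |max (-1) (min 1 (s x)) - max (-1) (min 1 (g x))| := by
          rw [min_eq_right hsx.2, max_eq_right hsx.1]
      _ ≤ |min 1 (s x) - min 1 (g x)| :=
          (abs_max_sub_max_le_max _ _ _ _).trans (max_le (by simp) le_rfl)
      _ ≤ |s x - g x| := (abs_min_sub_min_le_max _ _ _ _).trans (max_le (by simp) le_rfl)
  have hφ_int : Integrable φ ρ :=
    .of_bound hφ_cont.aestronglyMeasurable 1 (.of_forall hφ_le)
  exact ⟨φ, hφ_cont, hφ_le,
    (integral_mono (hs.sub hφ_int).abs (hs.sub hg_int).abs clip_le).trans hg⟩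

theorem tvDist_le_of_forall_continuous [TopologicalSpace.PseudoMetrizableSpace S]
    (μ ν : Measure S) [IsFiniteMeasure μ] [IsFiniteMeasure ν] {B : ℝ}
    (h : ∀ φ : S → ℝ, Continuous φ → (∀ x, |φ x| ≤ 1) → |∫ x, φ x ∂μ - ∫ x, φ x ∂ν| ≤ B) :
    tvDist μ ν ≤ B := by
  obtain ⟨s, hs, hs_le, hs_eq⟩ := exists_measurable_abs_le_one_tvDist_eq μ ν
  have hs_int (ρ : Measure S) [IsFiniteMeasure ρ] : Integrable s ρ :=
    .of_bound hs.aestronglyMeasurable 1 (.of_forall hs_le)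
  refine le_of_forall_pos_le_add fun ε hε => ?_
  obtain ⟨φ, hφ, hφ_le, hsφ⟩ :=
    exists_continuous_abs_le_one_integral_abs_sub_le (hs_int (μ + ν)) hs_le hε
  have hφ_int (ρ : Measure S) [IsFiniteMeasure ρ] : Integrable φ ρ :=
    .of_bound hφ.aestronglyMeasurable 1 (.of_forall hφ_le)
  have hsφ_int (ρ : Measure S) [IsFiniteMeasure ρ] : Integrable (fun x => |s x - φ x|) ρ :=
    ((hs_int ρ).sub (hφ_int ρ)).abs
  have abs_sub_le (ρ : Measure S) [IsFiniteMeasure ρ] :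
      |∫ x, s x ∂ρ - ∫ x, φ x ∂ρ| ≤ ∫ x, |s x - φ x| ∂ρ := by
    rw [← integral_sub (hs_int ρ) (hφ_int ρ)]
    exact abs_integral_le_integral_abs
  rw [integral_add_measure (hsφ_int μ) (hsφ_int ν)] at hsφ
  linarith [(abs_le.1 (abs_sub_le μ)).2, (abs_le.1 (abs_sub_le ν)).1, (abs_le.1 (h φ hφ hφ_le)).2]

end TotalVariation

section ImageDist

variable {Q : Measure ℝ} [IsFiniteMeasure Q] {f g : ℝ → ℝ}

theorem imageDist_self (Q : Measure ℝ) [IsFiniteMeasure Q] (f : ℝ → ℝ) : imageDist Q f f = 0 :=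
  tvDist_self _

theorem imageDist_le_of_forall_continuous (hf : Measurable f) (hg : Measurable g) {B : ℝ}
    (h : ∀ φ : ℝ → ℝ, Continuous φ → (∀ x, |φ x| ≤ 1) →
      |∫ x, φ (f x) ∂Q - ∫ x, φ (g x) ∂Q| ≤ B) :
    imageDist Q f g ≤ B := by
  refine tvDist_le_of_forall_continuous _ _ fun φ hφ hφ_le => ?_
  rw [integral_map hf.aemeasurable hφ.aestronglyMeasurable,
    integral_map hg.aemeasurable hφ.aestronglyMeasurable]
  exact h φ hφ hφ_le

theorem integrable_comp_of_abs_le (hf : Measurable f) {φ : ℝ → ℝ} (hφ : Continuous φ) {c : ℝ}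
    (hc : ∀ y, |φ y| ≤ c) : Integrable (fun x => φ (f x)) Q :=
  .of_bound (hφ.measurable.comp hf).aestronglyMeasurable c (.of_forall fun x => hc (f x))

/-- The law of `f` under `Q` is fractionally smooth of order `α`: by duality the estimate
`|E Φ'(f(X))| ≤ C ‖Φ‖_∞ ^ α ‖Φ'‖_∞ ^ (1 - α)` for all `C¹` functions `Φ` says that this law lies in
a Nikol'skii–Besov class. The derivative `ψ` of `Φ` and the bounds `b` and `c` on `Φ` and `ψ` are
separate arguments, so that no supremum has to be formed. -/
def NikolskiiBesovBound (Q : Measure ℝ) (f : ℝ → ℝ) (α C : ℝ) : Prop :=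
  ∀ (Φ ψ : ℝ → ℝ) (b c : ℝ), 0 < b → 0 < c → (∀ y, HasDerivAt Φ (ψ y) y) → Continuous ψ →
    (∀ y, |Φ y| ≤ b) → (∀ y, |ψ y| ≤ c) → |∫ x, ψ (f x) ∂Q| ≤ C * b ^ α * c ^ (1 - α)

theorem exists_hasDerivAt_of_continuous {φ : ℝ → ℝ} (hφ : Continuous φ) :
    ∃ F : ℝ → ℝ, ∀ y, HasDerivAt F (φ y) y :=
  ⟨fun y => ∫ t in (0 : ℝ)..y, φ t, fun y => (hφ.integral_hasStrictDerivAt 0 y).hasDerivAt⟩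

theorem abs_sub_le_of_forall_hasDerivAt {F φ : ℝ → ℝ} {c : ℝ} (hF : ∀ y, HasDerivAt F (φ y) y)
    (hc : ∀ y, |φ y| ≤ c) (x y : ℝ) : |F x - F y| ≤ c * |x - y| :=
  Convex.norm_image_sub_le_of_norm_hasDerivWithin_le (fun z _ => (hF z).hasDerivWithinAt)
    (fun z _ => hc z) convex_univ (Set.mem_univ y) (Set.mem_univ x)

theorem NikolskiiBesovBound.shiftCondition {α C : ℝ} (h : NikolskiiBesovBound Q f α C)
    (hf : Measurable f) (hC : 0 ≤ C) : ShiftCondition Q f α (C * 2 ^ (1 - α)) := by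
  intro u
  rcases eq_or_ne u 0 with rfl | hu
  · simp only [add_zero, imageDist_self]
    positivity
  refine imageDist_le_of_forall_continuous hf (hf.add_const u) fun φ hφ hφ_le => ?_
  obtain ⟨F, hF⟩ := exists_hasDerivAt_of_continuous hφ
  have hdiff := h (fun y => F y - F (y + u)) (fun y => φ y - φ (y + u)) |u| 2 (abs_pos.2 hu)
    two_pos (fun y => (hF y).sub ((hF (y + u)).comp_add_const y u)) (by fun_prop)
    (fun y => by simpa using abs_sub_le_of_forall_hasDerivAt hF hφ_le y (y + u))
    (fun y => (abs_sub _ _).trans (by linarith [hφ_le y, hφ_le (y + u)]))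
  rw [integral_sub (integrable_comp_of_abs_le hf hφ hφ_le)
    (integrable_comp_of_abs_le (hf.add_const u) hφ hφ_le)] at hdiff
  exact hdiff.trans_eq (by ring)

/-- The Steklov average of `φ` over intervals of length `ε` serves as the Lipschitz part. -/
theorem exists_lipschitz_add_deriv_of_abs_le_one {φ : ℝ → ℝ} (hφ : Continuous φ)
    (hφ_le : ∀ y, |φ y| ≤ 1) {ε : ℝ} (hε : 0 < ε) :
    ∃ χ Ψ : ℝ → ℝ, Continuous χ ∧ (∀ y, |χ y| ≤ 1) ∧ (∀ x y, |χ x - χ y| ≤ 2 / ε * |x - y|) ∧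
      (∀ y, HasDerivAt Ψ (φ y - χ y) y) ∧ ∀ y, |Ψ y| ≤ ε := by
  obtain ⟨F, hF⟩ := exists_hasDerivAt_of_continuous hφ
  have hF_cont : Continuous F := continuous_iff_continuousAt.2 fun x => (hF x).continuousAt
  obtain ⟨G, hG⟩ := exists_hasDerivAt_of_continuous hF_cont
  have hF_lip := abs_sub_le_of_forall_hasDerivAt hF hφ_le
  refine ⟨fun y => (F (y + ε) - F y) / ε, fun y => F y - (G (y + ε) - G y) / ε, by fun_prop,
    fun y => ?_, abs_sub_le_of_forall_hasDerivAt (φ := fun y => (φ (y + ε) - φ y) / ε)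
      (fun y => (((hF (y + ε)).comp_add_const y ε).sub (hF y)).div_const ε) fun y => ?_,
    fun y => (hF y).sub ((((hG (y + ε)).comp_add_const y ε).sub (hG y)).div_const ε), fun y => ?_⟩
  · rw [abs_div, abs_of_pos hε, div_le_one hε]
    simpa [abs_of_pos hε] using hF_lip (y + ε) y
  · rw [abs_div, abs_of_pos hε]
    gcongr
    exact (abs_sub _ _).trans (by linarith [hφ_le y, hφ_le (y + ε)])
  · obtain ⟨ξ, hξ, hFξ⟩ := exists_hasDerivAt_eq_slope G F (by linarith : y < y + ε)
      (fun x _ => (hG x).continuousAt.continuousWithinAt) fun x _ => hG x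
    rw [add_sub_cancel_left] at hFξ
    calc |F y - (G (y + ε) - G y) / ε| = |F y - F ξ| := by rw [hFξ]
      _ ≤ 1 * |y - ξ| := hF_lip y ξ
      _ ≤ ε := by rw [one_mul, abs_le]; constructor <;> linarith [hξ.1, hξ.2]

theorem NikolskiiBesovBound.imageDist_le {α C₁ C₂ ε : ℝ} (hfb : NikolskiiBesovBound Q f α C₁)
    (hgb : NikolskiiBesovBound Q g α C₂) (hf : Measurable f) (hg : Measurable g)
    (hfg : Integrable (fun x => f x - g x) Q) (hε : 0 < ε) :
    imageDist Q f g ≤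
      (C₁ + C₂) * 2 ^ (1 - α) * ε ^ α + 2 / ε * ∫ x, |f x - g x| ∂Q := by
  refine imageDist_le_of_forall_continuous hf hg fun φ hφ hφ_le => ?_
  obtain ⟨χ, Ψ, hχ, hχ_le, hχ_lip, hΨ, hΨ_le⟩ :=
    exists_lipschitz_add_deriv_of_abs_le_one hφ hφ_le hε
  have hφχ_le (y : ℝ) : |φ y - χ y| ≤ 2 :=
    (abs_sub _ _).trans (by linarith [hφ_le y, hχ_le y])
  have rough_f := hfb Ψ _ ε 2 hε two_pos hΨ (hφ.sub hχ) hΨ_le hφχ_le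
  have rough_g := hgb Ψ _ ε 2 hε two_pos hΨ (hφ.sub hχ) hΨ_le hφχ_le
  rw [integral_sub (integrable_comp_of_abs_le hf hφ hφ_le)
    (integrable_comp_of_abs_le hf hχ hχ_le)] at rough_f
  rw [integral_sub (integrable_comp_of_abs_le hg hφ hφ_le)
    (integrable_comp_of_abs_le hg hχ hχ_le)] at rough_g
  have smooth : |∫ x, χ (f x) ∂Q - ∫ x, χ (g x) ∂Q| ≤ 2 / ε * ∫ x, |f x - g x| ∂Q := by
    rw [← integral_sub (integrable_comp_of_abs_le hf hχ hχ_le)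
      (integrable_comp_of_abs_le hg hχ hχ_le), ← integral_const_mul, ← Real.norm_eq_abs]
    exact norm_integral_le_of_norm_le (hfg.abs.const_mul _) (.of_forall fun x => hχ_lip _ _)
  rw [abs_le] at rough_f rough_g smooth ⊢
  constructor <;> linarith

theorem exists_pos_div_eq_rpow_and_rpow_eq {δ k : ℝ} (hδ : 0 < δ) (hk : 0 < k) :
    ∃ ε : ℝ, 0 < ε ∧ δ / ε = δ ^ (1 / (k + 1)) ∧ ε ^ (1 / k) = δ ^ (1 / (k + 1)) := by
  refine ⟨δ ^ (k / (k + 1)), by positivity, ?_, ?_⟩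
  · rw [div_eq_iff (by positivity), ← Real.rpow_add hδ, ← add_div, add_comm 1 k,
      div_self (by positivity), Real.rpow_one]
  · rw [← Real.rpow_mul hδ.le]
    congr 1
    field_simp

theorem NikolskiiBesovBound.imageDist_le_rpow {k C₁ C₂ W δ : ℝ} (hk : 0 < k)
    (hfb : NikolskiiBesovBound Q f (1 / k) C₁) (hgb : NikolskiiBesovBound Q g (1 / k) C₂)
    (hf : Measurable f) (hg : Measurable g) (hfg : Integrable (fun x => f x - g x) Q)
    (hδ : 0 < δ) (hW : ∫ x, |f x - g x| ∂Q ≤ W * δ) :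
    imageDist Q f g ≤ ((C₁ + C₂) * 2 ^ (1 - 1 / k) + 2 * W) * δ ^ (1 / (k + 1)) := by
  obtain ⟨ε, hε, hδε, hεk⟩ := exists_pos_div_eq_rpow_and_rpow_eq hδ hk
  calc imageDist Q f g
      ≤ (C₁ + C₂) * 2 ^ (1 - 1 / k) * ε ^ (1 / k) + 2 / ε * ∫ x, |f x - g x| ∂Q :=
        hfb.imageDist_le hgb hf hg hfg hε
    _ ≤ (C₁ + C₂) * 2 ^ (1 - 1 / k) * ε ^ (1 / k) + 2 / ε * (W * δ) := by gcongr
    _ = (C₁ + C₂) * 2 ^ (1 - 1 / k) * ε ^ (1 / k) + 2 * W * (δ / ε) := by ring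
    _ = _ := by rw [hεk, hδε]; ring

end ImageDist

section ArgumentVariation

theorem integrable_multiset_sum_and_integral_le {S α : Type*} [MeasurableSpace S] {μ : Measure S}
    {g : α → S → ℝ} {c : ℝ} (hg : ∀ a, Integrable (g a) μ) (hc : ∀ a, ∫ x, g a x ∂μ ≤ c)
    (Z : Multiset α) :
    Integrable (fun x => (Z.map fun a => g a x).sum) μ ∧
      ∫ x, (Z.map fun a => g a x).sum ∂μ ≤ Z.card * c := by
  induction Z using Multiset.induction_on with
  | empty => simp
  | cons a Z ih =>
    simp only [Multiset.map_cons, Multiset.sum_cons, Multiset.card_cons]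
    refine ⟨(hg a).add ih.1, ?_⟩
    rw [integral_add (hg a) ih.1]
    push_cast
    linarith [hc a, ih.2]

theorem abs_im_one_div_ofReal_sub (z : ℂ) (x : ℝ) :
    |(1 / ((x : ℂ) - z)).im| = Real.pi * cauchyPDFReal z.re ‖z.im‖₊ x := by
  rw [cauchyPDFReal_def, coe_nnnorm, Real.norm_eq_abs, sq_abs, mul_assoc, mul_inv_cancel_left₀
    Real.pi_ne_zero, one_div, Complex.inv_im, abs_div, abs_of_nonneg (Complex.normSq_nonneg _),
    Complex.normSq_apply, div_eq_mul_inv]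
  simp [sq]

theorem integrable_abs_im_one_div_ofReal_sub (z : ℂ) :
    Integrable fun x : ℝ => |(1 / ((x : ℂ) - z)).im| := by
  simp_rw [abs_im_one_div_ofReal_sub]
  exact (integrable_cauchyPDFReal z.re).const_mul _

theorem integral_abs_im_one_div_ofReal_sub_le (z : ℂ) :
    ∫ x : ℝ, |(1 / ((x : ℂ) - z)).im| ≤ Real.pi := by
  simp_rw [abs_im_one_div_ofReal_sub, integral_const_mul]
  rcases eq_or_ne ‖z.im‖₊ 0 with h | h
  · simpa [h] using Real.pi_pos.le
  · rw [integral_cauchyPDFReal_eq_one _ h, mul_one]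

theorem abs_im_derivative_div_eval_le (q : ℂ[X]) (w : ℂ) :
    |(q.derivative.eval w / q.eval w).im| ≤ (q.roots.map fun z => |(1 / (w - z)).im|).sum := by
  rcases eq_or_ne (q.eval w) 0 with h | h
  · rw [h, div_zero, Complex.zero_im, abs_zero]
    exact Multiset.sum_nonneg (Multiset.forall_mem_map_iff.2 fun _ _ => abs_nonneg _)
  · rw [(IsAlgClosed.splits q).eval_derivative_div_eval_of_ne_zero h, ← Complex.imLm_coe,
      map_multiset_sum, Multiset.map_map]
    exact (Multiset.abs_sum_le_sum_abs).trans_eq (by simp)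

theorem integrable_abs_im_derivative_div_eval (q : ℂ[X]) :
    Integrable fun x : ℝ => |(q.derivative.eval (x : ℂ) / q.eval (x : ℂ)).im| := by
  have measurable_eval (r : ℂ[X]) : Measurable fun x : ℝ => r.eval (x : ℂ) :=
    (r.continuous.comp Complex.continuous_ofReal).measurable
  refine (integrable_multiset_sum_and_integral_le integrable_abs_im_one_div_ofReal_sub
    integral_abs_im_one_div_ofReal_sub_le q.roots).1.mono' (Measurable.aestronglyMeasurable
      (Complex.measurable_im.comp ((measurable_eval _).div (measurable_eval _))).abs)
        (.of_forall fun x => ?_)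
  rw [Real.norm_eq_abs, abs_abs]
  exact abs_im_derivative_div_eval_le q x

/-- `q' / q` is the logarithmic derivative of `q`, so this bounds the variation of the argument of
`q` along the real line. -/
theorem integral_abs_im_derivative_div_eval_le (q : ℂ[X]) :
    ∫ x : ℝ, |(q.derivative.eval (x : ℂ) / q.eval (x : ℂ)).im| ≤ q.natDegree * Real.pi := by
  obtain ⟨h_int, h_le⟩ := integrable_multiset_sum_and_integral_le
    integrable_abs_im_one_div_ofReal_sub integral_abs_im_one_div_ofReal_sub_le q.roots
  calc ∫ x : ℝ, |(q.derivative.eval (x : ℂ) / q.eval (x : ℂ)).im|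
      ≤ ∫ x : ℝ, (q.roots.map fun z => |(1 / ((x : ℂ) - z)).im|).sum :=
        integral_mono (integrable_abs_im_derivative_div_eval q) h_int fun x =>
          abs_im_derivative_div_eval_le q x
    _ ≤ q.roots.card * Real.pi := h_le
    _ ≤ q.natDegree * Real.pi := by
        gcongr
        exact q.card_roots'

theorem eval_ofReal_map_ofRealHom (p : ℝ[X]) (x : ℝ) :
    (p.map Complex.ofRealHom).eval (x : ℂ) = ((p.eval x : ℝ) : ℂ) :=
  eval_map_apply Complex.ofRealHom x

theorem mul_abs_derivative_div_sq_add_sq_eq (p : ℝ[X]) {τ : ℝ} (hτ : 0 < τ) (x : ℝ) :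
    τ * |p.derivative.eval x| / (p.eval x ^ 2 + τ ^ 2) =
      |((p.map Complex.ofRealHom - C (τ * Complex.I)).derivative.eval (x : ℂ) /
        (p.map Complex.ofRealHom - C (τ * Complex.I)).eval (x : ℂ)).im| := by
  rw [derivative_sub, derivative_C, sub_zero, derivative_map, eval_sub, eval_C,
    eval_ofReal_map_ofRealHom, eval_ofReal_map_ofRealHom, Complex.div_im]
  simp [Complex.normSq_apply, abs_div, abs_mul, abs_of_pos hτ, mul_comm τ, ← sq,
    abs_of_pos (by positivity : 0 < p.eval x ^ 2 + τ ^ 2)]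

theorem integrable_mul_abs_derivative_div_sq_add_sq (p : ℝ[X]) {τ : ℝ} (hτ : 0 < τ) :
    Integrable fun x => τ * |p.derivative.eval x| / (p.eval x ^ 2 + τ ^ 2) := by
  simp_rw [mul_abs_derivative_div_sq_add_sq_eq p hτ]
  exact integrable_abs_im_derivative_div_eval _

theorem integral_mul_abs_derivative_div_sq_add_sq_le (p : ℝ[X]) {τ : ℝ} (hτ : 0 < τ) :
    ∫ x, τ * |p.derivative.eval x| / (p.eval x ^ 2 + τ ^ 2) ≤ p.natDegree * Real.pi := by
  simp_rw [mul_abs_derivative_div_sq_add_sq_eq p hτ]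
  refine (integral_abs_im_derivative_div_eval_le _).trans ?_
  rw [natDegree_sub_C, natDegree_map]

end ArgumentVariation

section SmallBall

theorem norm_eval_eq_prod_roots (q : ℂ[X]) (w : ℂ) :
    ‖q.eval w‖ = ‖q.leadingCoeff‖ * (q.roots.map fun z => ‖w - z‖).prod := by
  rw [(IsAlgClosed.splits q).eval_eq_prod_roots, norm_mul]
  congr 1
  simpa only [Multiset.map_map, Function.comp_def, normHom_apply] using
    map_multiset_prod (normHom : ℂ →*₀ ℝ) (q.roots.map (w - ·))

theorem norm_eval_le_mahlerMeasure_mul (q : ℂ[X]) (w : ℂ) :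
    ‖q.eval w‖ ≤ q.mahlerMeasure * (1 + ‖w‖) ^ q.natDegree := by
  have norm_sub_le_mul (z : ℂ) : ‖w - z‖ ≤ max 1 ‖z‖ * (1 + ‖w‖) := by
    nlinarith [norm_sub_le w z, le_max_left 1 ‖z‖, le_max_right 1 ‖z‖, norm_nonneg w]
  calc ‖q.eval w‖ = ‖q.leadingCoeff‖ * (q.roots.map fun z => ‖w - z‖).prod :=
        norm_eval_eq_prod_roots q w
    _ ≤ ‖q.leadingCoeff‖ * (q.roots.map fun z => max 1 ‖z‖ * (1 + ‖w‖)).prod := by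
        gcongr
        exact Multiset.prod_map_le_prod_map₀ _ _ (fun z _ => norm_nonneg _)
          fun z _ => norm_sub_le_mul z
    _ = q.mahlerMeasure * (1 + ‖w‖) ^ q.natDegree := by
        rw [mahlerMeasure_eq_leadingCoeff_mul_prod_roots, Multiset.prod_map_mul,
          Multiset.map_const', Multiset.prod_replicate, mul_assoc,
          splits_iff_card_roots.1 (IsAlgClosed.splits q)]

theorem exists_mem_roots_norm_sub_lt {q : ℂ[X]} {n : ℕ} (hn : q.natDegree ≤ n) {η : ℝ}
    (hη₀ : 0 ≤ η) (hη₁ : η ≤ 1) {w : ℂ} (hw : ‖q.eval w‖ < q.mahlerMeasure * η ^ n) :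
    ∃ z ∈ q.roots, ‖w - z‖ < max 1 ‖z‖ * η := by
  contrapose! hw
  calc q.mahlerMeasure * η ^ n
      ≤ q.mahlerMeasure * η ^ q.roots.card :=
        mul_le_mul_of_nonneg_left (pow_le_pow_of_le_one hη₀ hη₁ (q.card_roots'.trans hn))
          q.mahlerMeasure_nonneg
    _ = ‖q.leadingCoeff‖ * (q.roots.map fun z => max 1 ‖z‖ * η).prod := by
        rw [mahlerMeasure_eq_leadingCoeff_mul_prod_roots, Multiset.prod_map_mul,
          Multiset.map_const', Multiset.prod_replicate, mul_assoc]
    _ ≤ ‖q.leadingCoeff‖ * (q.roots.map fun z => ‖w - z‖).prod := by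
        gcongr
        exact Multiset.prod_map_le_prod_map₀ _ _ (fun z _ => by positivity) hw
    _ = ‖q.eval w‖ := (norm_eval_eq_prod_roots q w).symm

theorem gaussianPDFReal_zero_one (x : ℝ) :
    gaussianPDFReal 0 1 x = (Real.sqrt (2 * Real.pi))⁻¹ * Real.exp (-x ^ 2 / 2) := by
  simp [gaussianPDFReal_def]

theorem one_add_abs_mul_gaussianPDFReal_le_one (x : ℝ) :
    (1 + |x|) * gaussianPDFReal 0 1 x ≤ 1 := by
  have two_le_sqrt : 2 ≤ Real.sqrt (2 * Real.pi) :=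
    Real.le_sqrt_of_sq_le (by linarith [Real.pi_gt_three])
  have le_exp : 1 + |x| ≤ 2 * Real.exp (x ^ 2 / 2) := by
    nlinarith [Real.add_one_le_exp (x ^ 2 / 2), sq_nonneg (1 - |x|), sq_abs x]
  calc (1 + |x|) * gaussianPDFReal 0 1 x
      ≤ 2 * Real.exp (x ^ 2 / 2) * (2⁻¹ * Real.exp (-x ^ 2 / 2)) := by
        rw [gaussianPDFReal_zero_one]
        gcongr
    _ = Real.exp (x ^ 2 / 2) * Real.exp (-x ^ 2 / 2) := by ring
    _ = 1 := by rw [← Real.exp_add, neg_div, add_neg_cancel, Real.exp_zero]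

theorem stdGauss_real_norm_sub_lt_le (z : ℂ) {η : ℝ} (hη : 0 ≤ η) :
    stdGauss.real {x : ℝ | ‖(x : ℂ) - z‖ < max 1 ‖z‖ * η} ≤ 4 * η := by
  rcases le_total 1 (4 * η) with hη_large | hη_small
  · exact measureReal_le_one.trans hη_large
  set M : ℝ := max 1 ‖z‖
  have hM : 0 < M := zero_lt_one.trans_le (le_max_left _ _)
  set A : Set ℝ := {x : ℝ | ‖(x : ℂ) - z‖ < M * η}
  have subset_ball : A ⊆ Metric.ball z.re (M * η) := fun x hx => by
    rw [Metric.mem_ball, Real.dist_eq]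
    exact (Complex.abs_re_le_norm ((x : ℂ) - z)).trans_lt hx
  have density_le (x : ℝ) (hx : x ∈ A) : gaussianPDFReal 0 1 x ≤ 2 / M := by
    have hMx : M ≤ 2 * (1 + |x|) := by
      have hz : ‖z‖ < |x| + M * η := by
        have := norm_le_norm_add_norm_sub (x : ℂ) z
        rw [Complex.norm_real, Real.norm_eq_abs] at this
        exact this.trans_lt (by gcongr; exact hx)
      rcases max_choice 1 ‖z‖ with h | h <;> nlinarith [abs_nonneg x]
    rw [le_div_iff₀ hM]
    nlinarith [one_add_abs_mul_gaussianPDFReal_le_one x, gaussianPDFReal_nonneg 0 1 x]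
  refine ENNReal.toReal_le_of_le_ofReal (by positivity) ?_
  calc stdGauss A = ∫⁻ x in A, gaussianPDF 0 1 x := gaussianReal_apply 0 one_ne_zero A
    _ ≤ ∫⁻ _ in A, ENNReal.ofReal (2 / M) :=
        setLIntegral_mono measurable_const fun x hx => ENNReal.ofReal_le_ofReal (density_le x hx)
    _ ≤ ENNReal.ofReal (2 / M) * volume (Metric.ball z.re (M * η)) := by
        rw [setLIntegral_const]
        gcongr
    _ = ENNReal.ofReal (4 * η) := by
        rw [Real.volume_ball, ← ENNReal.ofReal_mul (by positivity)]
        congr 1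
        field_simp
        ring

theorem integrable_one_add_abs_pow (k : ℕ) :
    Integrable (fun x : ℝ => (1 + |x|) ^ k) stdGauss := by
  have h : MemLp (fun x : ℝ => 1 + |x|) k stdGauss :=
    (memLp_const (1 : ℝ)).add (memLp_id_gaussianReal' (k : ENNReal) (by simp)).abs
  refine h.integrable_norm_pow'.congr (.of_forall fun x => ?_)
  dsimp only
  rw [Real.norm_of_nonneg (by positivity)]

theorem stdGauss_real_abs_eval_lt_le {p : ℝ[X]} (hp : p ≠ 0) {n : ℕ} (hn₀ : n ≠ 0)
    (hn : p.natDegree ≤ n) {t : ℝ} (ht : 0 ≤ t) :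
    stdGauss.real {x | |p.eval x| < t} ≤
      4 * n * (t / (p.map Complex.ofRealHom).mahlerMeasure) ^ (1 / n : ℝ) := by
  set q := p.map Complex.ofRealHom
  have hq : 0 < q.mahlerMeasure := mahlerMeasure_pos_of_ne_zero (by simpa [q] using hp)
  set η : ℝ := (t / q.mahlerMeasure) ^ (1 / n : ℝ)
  have hη₀ : 0 ≤ η := by positivity
  have ht_eq : t = q.mahlerMeasure * η ^ n := by
    rw [← Real.rpow_natCast, ← Real.rpow_mul (by positivity), one_div_mul_cancel (by positivity),
      Real.rpow_one, mul_div_cancel₀ _ hq.ne']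
  rcases le_total 1 η with hη | hη
  · have : (1 : ℝ) ≤ n := by exact_mod_cast Nat.one_le_iff_ne_zero.2 hn₀
    exact measureReal_le_one.trans (by nlinarith)
  have near_root : {x | |p.eval x| < t} ⊆
      ⋃ z ∈ q.roots.toFinset, {x : ℝ | ‖(x : ℂ) - z‖ < max 1 ‖z‖ * η} := fun x hx => by
    obtain ⟨z, hz, hxz⟩ := exists_mem_roots_norm_sub_lt (q := q) (w := x)
      (natDegree_map_le.trans hn) hη₀ hη (by
        rw [eval_ofReal_map_ofRealHom, Complex.norm_real, Real.norm_eq_abs, ← ht_eq]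
        exact hx)
    exact Set.mem_iUnion₂.2 ⟨z, Multiset.mem_toFinset.2 hz, hxz⟩
  calc stdGauss.real {x | |p.eval x| < t}
      ≤ ∑ z ∈ q.roots.toFinset, stdGauss.real {x : ℝ | ‖(x : ℂ) - z‖ < max 1 ‖z‖ * η} :=
        (measureReal_mono near_root (measure_ne_top _ _)).trans (measureReal_biUnion_finset_le _ _)
    _ ≤ q.roots.toFinset.card * (4 * η) := by
        rw [← nsmul_eq_mul]
        exact Finset.sum_le_card_nsmul _ _ _ fun z _ => stdGauss_real_norm_sub_lt_le z hη₀
    _ ≤ n * (4 * η) := by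
        gcongr
        exact q.roots.toFinset_card_le.trans (q.card_roots'.trans (natDegree_map_le.trans hn))
    _ = 4 * n * η := by ring

theorem abs_eval_le_mahlerMeasure_mul (p : ℝ[X]) (x : ℝ) :
    |p.eval x| ≤ (p.map Complex.ofRealHom).mahlerMeasure * (1 + |x|) ^ p.natDegree := by
  have h := norm_eval_le_mahlerMeasure_mul (p.map Complex.ofRealHom) x
  rwa [eval_ofReal_map_ofRealHom, Complex.norm_real, Complex.norm_real, natDegree_map] at h

theorem integrable_eval (p : ℝ[X]) : Integrable (fun x => p.eval x) stdGauss :=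
  ((integrable_one_add_abs_pow p.natDegree).const_mul _).mono' p.continuous.aestronglyMeasurable
    (.of_forall (abs_eval_le_mahlerMeasure_mul p))

theorem integrable_eval_sq (p : ℝ[X]) : Integrable (fun x => p.eval x ^ 2) stdGauss :=
  (integrable_eval (p ^ 2)).congr (.of_forall fun _ => eval_pow 2)

theorem sqrt_integral_eval_sq_le (p : ℝ[X]) {n : ℕ} (hn : p.natDegree ≤ n) :
    Real.sqrt (∫ x, p.eval x ^ 2 ∂stdGauss) ≤ (p.map Complex.ofRealHom).mahlerMeasure *
      Real.sqrt (∫ x, (1 + |x|) ^ (2 * n) ∂stdGauss) := by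
  have hM := (p.map Complex.ofRealHom).mahlerMeasure_nonneg
  refine Real.sqrt_le_iff.2 ⟨by positivity, ?_⟩
  rw [mul_pow, Real.sq_sqrt (by positivity), ← integral_const_mul]
  refine integral_mono (integrable_eval_sq p) ((integrable_one_add_abs_pow _).const_mul _)
    fun x => ?_
  calc p.eval x ^ 2 = |p.eval x| ^ 2 := (sq_abs _).symm
    _ ≤ ((p.map Complex.ofRealHom).mahlerMeasure * (1 + |x|) ^ n) ^ 2 := by
        gcongr
        refine (abs_eval_le_mahlerMeasure_mul p x).trans ?_
        gcongr
        exact le_add_of_nonneg_right (abs_nonneg x)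
    _ = _ := by rw [mul_pow, ← pow_mul, mul_comm n]

theorem integral_le_of_measureReal_lt_le_rpow {S : Type*} [MeasurableSpace S] {μ : Measure S}
    [IsFiniteMeasure μ] {F : S → ℝ} (hF : AEStronglyMeasurable F μ) (hF₀ : ∀ x, 0 ≤ F x)
    (hF₁ : ∀ x, F x ≤ 1) {K β : ℝ} (hβ : β < 1)
    (h : ∀ t ∈ Set.Ioc (0 : ℝ) 1, μ.real {x | t < F x} ≤ K * t ^ (-β)) :
    ∫ x, F x ∂μ ≤ K / (1 - β) := by
  have hF_int : Integrable F μ :=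
    .of_bound hF 1 (.of_forall fun x => by rw [Real.norm_of_nonneg (hF₀ x)]; exact hF₁ x)
  have integrable_rpow : IntegrableOn (fun t : ℝ => K * t ^ (-β)) (Set.Ioc 0 1) :=
    ((intervalIntegrable_iff_integrableOn_Ioc_of_le zero_le_one).1
      (intervalIntegral.intervalIntegrable_rpow' (by linarith))).const_mul _
  calc ∫ x, F x ∂μ = ∫ t in Set.Ioi 0, μ.real {x | t < F x} :=
        hF_int.integral_eq_integral_meas_lt (.of_forall hF₀)
    _ = ∫ t in Set.Ioc 0 1, μ.real {x | t < F x} := by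
        refine setIntegral_eq_of_subset_of_forall_sdiff_eq_zero measurableSet_Ioi
          Set.Ioc_subset_Ioi_self fun t ht => ?_
        have ht₁ : 1 < t := not_le.1 fun h => ht.2 ⟨ht.1, h⟩
        have hempty : {x | t < F x} = ∅ := Set.eq_empty_of_forall_notMem fun x hx =>
          ((hF₁ x).trans_lt ht₁).not_gt hx
        rw [hempty, measureReal_empty]
    _ ≤ ∫ t in Set.Ioc 0 1, K * t ^ (-β) :=
        integral_mono_of_nonneg (.of_forall fun t => measureReal_nonneg) integrable_rpow
          ((ae_restrict_mem measurableSet_Ioc).mono h)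
    _ = K / (1 - β) := by
        rw [integral_const_mul, ← intervalIntegral.integral_of_le zero_le_one,
          integral_rpow (.inl (by linarith)), Real.one_rpow, Real.zero_rpow (by linarith)]
        ring

theorem abs_lt_mul_rpow_of_lt_sq_div_sq_add_sq {t τ y : ℝ} (ht : 0 < t) (hτ : 0 < τ)
    (h : t < τ ^ 2 / (y ^ 2 + τ ^ 2)) : |y| < τ * t ^ (-1 / 2 : ℝ) := by
  have hmul : t * (y ^ 2 + τ ^ 2) < τ ^ 2 := (lt_div_iff₀ (by positivity)).1 h
  have sq_rpow : (t ^ (-1 / 2 : ℝ)) ^ 2 = t⁻¹ := by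
    rw [← Real.rpow_mul_natCast ht.le, ← Real.rpow_neg_one]
    norm_num
  refine abs_lt_of_sq_lt_sq ?_ (by positivity)
  rw [mul_pow, sq_rpow, ← div_eq_mul_inv, lt_div_iff₀ ht]
  nlinarith [mul_pos ht (pow_pos hτ 2)]

theorem integral_sq_div_sq_add_sq_le {S : Type*} [MeasurableSpace S] {μ : Measure S}
    [IsFiniteMeasure μ] {g : S → ℝ} (hg : Measurable g) {C α : ℝ} (hα : α < 2)
    (h : ∀ t, 0 < t → μ.real {x | |g x| < t} ≤ C * t ^ α) {τ : ℝ} (hτ : 0 < τ) :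
    ∫ x, τ ^ 2 / (g x ^ 2 + τ ^ 2) ∂μ ≤ C / (1 - α / 2) * τ ^ α := by
  refine (integral_le_of_measureReal_lt_le_rpow (K := C * τ ^ α) (β := α / 2)
    (Measurable.aestronglyMeasurable (by fun_prop)) (fun x => by positivity) (fun x => ?_)
    (by linarith) fun t ht => ?_).trans_eq (by ring)
  · exact div_le_one_of_le₀ (by linarith [sq_nonneg (g x)]) (by positivity)
  · have ht₀ : 0 < t := ht.1
    calc μ.real {x | t < τ ^ 2 / (g x ^ 2 + τ ^ 2)}
        ≤ μ.real {x | |g x| < τ * t ^ (-1 / 2 : ℝ)} :=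
          measureReal_mono fun x hx => abs_lt_mul_rpow_of_lt_sq_div_sq_add_sq ht₀ hτ hx
      _ ≤ C * (τ * t ^ (-1 / 2 : ℝ)) ^ α := h _ (by positivity)
      _ = C * τ ^ α * t ^ (-(α / 2)) := by
          rw [Real.mul_rpow hτ.le (by positivity), ← Real.rpow_mul ht₀.le]
          ring_nf

theorem stdGauss_real_abs_eval_lt_le_of_le_sqrt {p : ℝ[X]} {n : ℕ} (hn₀ : n ≠ 0)
    (hn : p.natDegree ≤ n) {s : ℝ} (hs : 0 < s) (hp : s ≤ Real.sqrt (∫ x, p.eval x ^ 2 ∂stdGauss))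
    {t : ℝ} (ht : 0 ≤ t) :
    stdGauss.real {x | |p.eval x| < t} ≤
      4 * n * (Real.sqrt (∫ x, (1 + |x|) ^ (2 * n) ∂stdGauss) / s) ^ (1 / n : ℝ) *
        t ^ (1 / n : ℝ) := by
  have hp₀ : p ≠ 0 := by
    rintro rfl
    exact hs.not_ge (by simpa using hp)
  have hM : 0 < (p.map Complex.ofRealHom).mahlerMeasure :=
    mahlerMeasure_pos_of_ne_zero (by simpa using hp₀)
  have hsM := hp.trans (sqrt_integral_eval_sq_le p hn)
  refine (stdGauss_real_abs_eval_lt_le hp₀ hn₀ hn ht).trans ?_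
  rw [mul_assoc (4 * (n : ℝ)), ← Real.mul_rpow (by positivity) ht]
  gcongr
  rw [div_mul_eq_mul_div, div_le_div_iff₀ hM hs]
  nlinarith

theorem exists_integral_sq_div_sq_add_sq_le_rpow {n : ℕ} (hn₀ : n ≠ 0) {s : ℝ} (hs : 0 < s) :
    ∃ C : ℝ, 0 ≤ C ∧ ∀ p : ℝ[X], p.natDegree ≤ n →
      s ≤ Real.sqrt (∫ x, p.eval x ^ 2 ∂stdGauss) → ∀ τ : ℝ, 0 < τ →
        ∫ x, τ ^ 2 / (p.eval x ^ 2 + τ ^ 2) ∂stdGauss ≤ C * τ ^ (1 / n : ℝ) := by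
  have hα : (1 : ℝ) / n ≤ 1 := by
    rw [div_le_one (by positivity)]
    exact_mod_cast Nat.one_le_iff_ne_zero.2 hn₀
  have hα' : 0 < 1 - (1 : ℝ) / n / 2 := by linarith
  refine ⟨4 * n * (Real.sqrt (∫ x, (1 + |x|) ^ (2 * n) ∂stdGauss) / s) ^ (1 / n : ℝ) /
    (1 - 1 / n / 2), by positivity, fun p hp hsp τ hτ => ?_⟩
  exact integral_sq_div_sq_add_sq_le p.continuous.measurable (by linarith)
    (fun t ht => stdGauss_real_abs_eval_lt_le_of_le_sqrt hn₀ hp hs hsp ht.le) hτ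

end SmallBall

section GaussianIntegrationByParts

theorem integrable_gaussianPDFReal_mul {μ : ℝ} {v : NNReal} (hv : v ≠ 0) {g : ℝ → ℝ}
    (hg : Integrable g (gaussianReal μ v)) : Integrable fun x => gaussianPDFReal μ v x * g x := by
  rw [gaussianReal_of_var_ne_zero μ hv,
    integrable_withDensity_iff_integrable_smul' (measurable_gaussianPDF μ v)
      (.of_forall fun _ => gaussianPDF_lt_top)] at hg
  simpa only [toReal_gaussianPDF, smul_eq_mul] using hg

theorem hasDerivAt_gaussianPDFReal (μ : ℝ) (v : NNReal) (x : ℝ) :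
    HasDerivAt (gaussianPDFReal μ v) (-((x - μ) / v * gaussianPDFReal μ v x)) x := by
  have h := ((((hasDerivAt_id x).sub_const μ).pow 2).neg.div_const (2 * v : ℝ)).exp.const_mul
    (Real.sqrt (2 * Real.pi * v))⁻¹
  refine h.congr_deriv ?_
  simp only [gaussianPDFReal, id_eq, Nat.cast_ofNat, Nat.add_one_sub_one, pow_one, mul_one,
    Pi.neg_apply, Pi.pow_apply]
  field_simp

theorem mul_integral_deriv_gaussianReal {μ : ℝ} {v : NNReal} {g g' : ℝ → ℝ}
    (hg : ∀ x, HasDerivAt g (g' x) x) (hg_int : Integrable g (gaussianReal μ v))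
    (hg'_int : Integrable g' (gaussianReal μ v))
    (hxg_int : Integrable (fun x => (x - μ) * g x) (gaussianReal μ v)) :
    v * ∫ x, g' x ∂gaussianReal μ v = ∫ x, (x - μ) * g x ∂gaussianReal μ v := by
  rcases eq_or_ne v 0 with rfl | hv
  · simp [gaussianReal_zero_var]
  have hg'_pdf := integrable_gaussianPDFReal_mul hv hg'_int
  have hxg_pdf := (integrable_gaussianPDFReal_mul hv hxg_int).const_mul (v : ℝ)⁻¹
  have hderiv (x : ℝ) : HasDerivAt (fun x => gaussianPDFReal μ v x * g x)
      (gaussianPDFReal μ v x * g' x - (v : ℝ)⁻¹ * (gaussianPDFReal μ v x * ((x - μ) * g x))) x :=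
    ((hasDerivAt_gaussianPDFReal μ v x).mul (hg x)).congr_deriv (by ring)
  have h := integral_eq_zero_of_hasDerivAt_of_integrable hderiv (hg'_pdf.sub hxg_pdf)
    (integrable_gaussianPDFReal_mul hv hg_int)
  rw [integral_sub hg'_pdf hxg_pdf, integral_const_mul, sub_eq_zero] at h
  simp only [integral_gaussianReal_eq_integral_smul hv, smul_eq_mul]
  rw [h, mul_inv_cancel_left₀ (by exact_mod_cast hv)]

theorem integrable_abs_stdGauss : Integrable (fun x : ℝ => |x|) stdGauss := by
  simpa only [eval_X] using (integrable_eval X).abs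

theorem abs_integral_deriv_mul_le {F F' k k' : ℝ → ℝ} {b κ : ℝ}
    (hF : ∀ x, HasDerivAt F (F' x) x) (hk : ∀ x, HasDerivAt k (k' x) x) (hb : ∀ x, |F x| ≤ b)
    (hκ : ∀ x, |k x| ≤ κ) (hF'k : Integrable (fun x => F' x * k x) stdGauss)
    (hk' : Integrable k' stdGauss) :
    |∫ x, F' x * k x ∂stdGauss| ≤ b * (κ * ∫ x, |x| ∂stdGauss + ∫ x, |k' x| ∂stdGauss) := by
  have hF_meas : AEStronglyMeasurable F stdGauss :=
    (continuous_iff_continuousAt.2 fun x => (hF x).continuousAt).aestronglyMeasurable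
  have hk_meas : AEStronglyMeasurable k stdGauss :=
    (continuous_iff_continuousAt.2 fun x => (hk x).continuousAt).aestronglyMeasurable
  have hx : Integrable (fun x : ℝ => x) stdGauss := by simpa only [eval_X] using integrable_eval X
  have integrable_F_mul {h : ℝ → ℝ} (hh : Integrable h stdGauss) :
      Integrable (fun x => F x * h x) stdGauss :=
    hh.bdd_mul (c := b) hF_meas (.of_forall hb)
  have hxFk : Integrable (fun x => F x * (x * k x)) stdGauss :=
    integrable_F_mul (hx.mul_bdd (c := κ) hk_meas (.of_forall hκ))
  have hFk' := integrable_F_mul hk'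
  have stein : ∫ x, F' x * k x ∂stdGauss = ∫ x, F x * (x * k x) - F x * k' x ∂stdGauss := by
    have h := mul_integral_deriv_gaussianReal (μ := 0) (v := 1) (fun x => (hF x).mul (hk x))
      (integrable_F_mul (.of_bound hk_meas κ (.of_forall hκ))) (hF'k.add hFk')
      (hxFk.congr (.of_forall fun x => by dsimp; ring))
    rw [integral_add hF'k hFk', NNReal.coe_one, one_mul] at h
    rw [integral_sub hxFk hFk', eq_sub_iff_add_eq, h]
    exact integral_congr_ae (.of_forall fun x => by dsimp; ring)
  rw [stein, ← integral_const_mul, ← integral_add (integrable_abs_stdGauss.const_mul κ) hk'.abs,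
    ← integral_const_mul, ← Real.norm_eq_abs]
  refine norm_integral_le_of_norm_le
    (((integrable_abs_stdGauss.const_mul κ).add hk'.abs).const_mul b) (.of_forall fun x => ?_)
  calc |F x * (x * k x) - F x * k' x| = |F x| * |k x * x - k' x| := by rw [← abs_mul]; ring_nf
    _ ≤ b * (κ * |x| + |k' x|) := by
        gcongr
        · exact (abs_nonneg _).trans (hb x)
        · exact hb x
        · refine (abs_sub _ _).trans ?_
          rw [abs_mul]
          gcongr
          exact hκ x

end GaussianIntegrationByParts

section RegularizedReciprocal

theorem hasDerivAt_div_sq_add_sq {p : ℝ → ℝ} {p' τ x : ℝ} (hτ : τ ≠ 0) (hp : HasDerivAt p p' x) :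
    HasDerivAt (fun x => p x / (p x ^ 2 + τ ^ 2))
      (p' * (τ ^ 2 - p x ^ 2) / (p x ^ 2 + τ ^ 2) ^ 2) x := by
  have hne : p x ^ 2 + τ ^ 2 ≠ 0 := by positivity
  refine (hp.div ((hp.pow 2).add_const (τ ^ 2)) hne).congr_deriv ?_
  simp only [Pi.pow_apply]
  congr 1
  push_cast
  ring

theorem abs_div_sq_add_sq_le (y : ℝ) {τ : ℝ} (hτ : 0 < τ) : |y / (y ^ 2 + τ ^ 2)| ≤ 1 / τ := by
  rw [abs_div, abs_of_pos (by positivity : 0 < y ^ 2 + τ ^ 2), div_le_div_iff₀ (by positivity) hτ]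
  nlinarith [sq_nonneg (|y| - τ), sq_abs y, sq_nonneg y, sq_nonneg τ]

theorem abs_mul_sub_div_sq_le (a y : ℝ) {τ : ℝ} (hτ : 0 < τ) :
    |a * (τ ^ 2 - y ^ 2) / (y ^ 2 + τ ^ 2) ^ 2| ≤ τ * |a| / (y ^ 2 + τ ^ 2) / τ := by
  have hpos : 0 < y ^ 2 + τ ^ 2 := by positivity
  have hsub : |τ ^ 2 - y ^ 2| ≤ y ^ 2 + τ ^ 2 :=
    abs_le.2 ⟨by linarith [sq_nonneg τ], by linarith [sq_nonneg y]⟩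
  calc |a * (τ ^ 2 - y ^ 2) / (y ^ 2 + τ ^ 2) ^ 2|
      = |a| * |τ ^ 2 - y ^ 2| / (y ^ 2 + τ ^ 2) ^ 2 := by
        rw [abs_div, abs_mul, abs_of_pos (pow_pos hpos 2)]
    _ ≤ |a| * (y ^ 2 + τ ^ 2) / (y ^ 2 + τ ^ 2) ^ 2 := by gcongr
    _ = τ * |a| / (y ^ 2 + τ ^ 2) / τ := by field_simp

theorem stdGauss_le_volume : stdGauss ≤ volume := by
  rw [stdGauss, gaussianReal_of_var_ne_zero 0 one_ne_zero]
  calc volume.withDensity (gaussianPDF 0 1) ≤ volume.withDensity 1 :=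
        withDensity_mono (.of_forall fun x => ENNReal.ofReal_le_one.2 ?_)
    _ = volume := withDensity_one
  have h := one_add_abs_mul_gaussianPDFReal_le_one x
  nlinarith [mul_nonneg (abs_nonneg x) (gaussianPDFReal_nonneg 0 1 x)]

theorem integrable_deriv_div_sq_add_sq (p : ℝ[X]) {τ : ℝ} (hτ : 0 < τ) :
    Integrable (fun x => p.derivative.eval x * (τ ^ 2 - p.eval x ^ 2) /
      (p.eval x ^ 2 + τ ^ 2) ^ 2) stdGauss := by
  refine ((((integrable_mul_abs_derivative_div_sq_add_sq p hτ).div_const τ).mono_measure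
    stdGauss_le_volume).mono' ?_ (.of_forall fun x => abs_mul_sub_div_sq_le _ _ hτ))
  exact (Continuous.div (by fun_prop) (by fun_prop) fun x => by positivity).aestronglyMeasurable

theorem integral_abs_deriv_div_sq_add_sq_le (p : ℝ[X]) {τ : ℝ} (hτ : 0 < τ) :
    ∫ x, |p.derivative.eval x * (τ ^ 2 - p.eval x ^ 2) / (p.eval x ^ 2 + τ ^ 2) ^ 2| ∂stdGauss ≤
      p.natDegree * Real.pi / τ := by
  have hint := (integrable_mul_abs_derivative_div_sq_add_sq p hτ).div_const τ
  calc ∫ x, |p.derivative.eval x * (τ ^ 2 - p.eval x ^ 2) / (p.eval x ^ 2 + τ ^ 2) ^ 2| ∂stdGauss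
      ≤ ∫ x, τ * |p.derivative.eval x| / (p.eval x ^ 2 + τ ^ 2) / τ ∂stdGauss :=
        integral_mono (integrable_deriv_div_sq_add_sq p hτ).abs
          (hint.mono_measure stdGauss_le_volume) fun x => abs_mul_sub_div_sq_le _ _ hτ
    _ ≤ ∫ x, τ * |p.derivative.eval x| / (p.eval x ^ 2 + τ ^ 2) / τ :=
        integral_mono_measure stdGauss_le_volume (.of_forall fun x => by positivity) hint
    _ ≤ p.natDegree * Real.pi / τ := by
        rw [integral_div]
        gcongr
        exact integral_mul_abs_derivative_div_sq_add_sq_le p hτ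

theorem integrable_sq_div_sq_add_sq (p : ℝ[X]) {τ : ℝ} (hτ : 0 < τ) :
    Integrable (fun x => τ ^ 2 / (p.eval x ^ 2 + τ ^ 2)) stdGauss := by
  refine .of_bound (Continuous.aestronglyMeasurable ?_) 1 (.of_forall fun x => ?_)
  · exact continuous_const.div (by fun_prop) fun x => by positivity
  · rw [Real.norm_of_nonneg (by positivity)]
    exact div_le_one_of_le₀ (by linarith [sq_nonneg (p.eval x)]) (by positivity)

end RegularizedReciprocal

section GradNorm

theorem stdGauss_eval_ne_zero {p : ℝ[X]} (hp : p ≠ 0) : stdGauss {x | p.eval x ≠ 0} = 1 := by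
  have hroots : {x | p.eval x ≠ 0} = (↑p.roots.toFinset : Set ℝ)ᶜ := by
    ext x
    simp [hp]
  have : NullSingletonClass stdGauss := nullSingletonClass_gaussianReal one_ne_zero
  rw [hroots, prob_compl_eq_one_sub (Finset.measurableSet _), Finset.measure_zero, tsub_zero]

theorem integral_pos_of_eval_ne_zero {p : ℝ[X]} (hp : p ≠ 0) {g : ℝ → ℝ} (hg₀ : 0 ≤ g)
    (hg : Integrable g stdGauss) (h : ∀ x, p.eval x ≠ 0 → g x ≠ 0) :
    0 < ∫ x, g x ∂stdGauss := by
  rw [integral_pos_iff_support_of_nonneg hg₀ hg]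
  exact (stdGauss_eval_ne_zero hp ▸ one_pos).trans_le (measure_mono h)

theorem gradNorm_pos {f : ℝ[X]} (hf : 1 ≤ f.natDegree) : 0 < gradNorm f := by
  have hf' : f.derivative ≠ 0 := fun h => by
    have := derivative_eq_zero.1 h
    omega
  exact Real.sqrt_pos.2 (integral_pos_of_eval_ne_zero hf' (fun x => sq_nonneg _)
    (integrable_eval_sq _) fun x => pow_ne_zero 2)

end GradNorm

section PolynomialImages

variable {Φ ψ : ℝ → ℝ} {b c : ℝ}

theorem abs_integral_comp_eval_mul_derivative_mul_le (hΦ : ∀ y, HasDerivAt Φ (ψ y) y)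
    (hψ : Continuous ψ) (hb : ∀ y, |Φ y| ≤ b) (hc : ∀ y, |ψ y| ≤ c) (f : ℝ[X]) {k k' : ℝ → ℝ}
    {κ : ℝ} (hk : ∀ x, HasDerivAt k (k' x) x) (hκ : ∀ x, |k x| ≤ κ)
    (hk' : Integrable k' stdGauss) :
    |∫ x, ψ (f.eval x) * (f.derivative.eval x * k x) ∂stdGauss| ≤
      b * (κ * ∫ x, |x| ∂stdGauss + ∫ x, |k' x| ∂stdGauss) := by
  have hk_meas : AEStronglyMeasurable k stdGauss :=
    (continuous_iff_continuousAt.2 fun x => (hk x).continuousAt).aestronglyMeasurable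
  have hint : Integrable (fun x => ψ (f.eval x) * f.derivative.eval x * k x) stdGauss :=
    ((integrable_eval f.derivative).bdd_mul (c := c) (by fun_prop)
      (.of_forall fun x => hc _)).mul_bdd (c := κ) hk_meas (.of_forall hκ)
  simpa only [mul_assoc] using
    abs_integral_deriv_mul_le (fun x => (hΦ _).comp x (f.hasDerivAt x)) hk (fun x => hb _) hκ
      hint hk'

/-- Stein's identity requires dividing by `f'`, which may vanish. Dividing by
`f' + τ ^ 2 / f'` instead costs the second term. -/
theorem abs_integral_comp_eval_le (hΦ : ∀ y, HasDerivAt Φ (ψ y) y) (hψ : Continuous ψ)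
    (hb : ∀ y, |Φ y| ≤ b) (hc : ∀ y, |ψ y| ≤ c) (f : ℝ[X]) {τ : ℝ} (hτ : 0 < τ) :
    |∫ x, ψ (f.eval x) ∂stdGauss| ≤
      (∫ x, |x| ∂stdGauss + f.derivative.natDegree * Real.pi) * (b / τ) +
        c * ∫ x, τ ^ 2 / (f.derivative.eval x ^ 2 + τ ^ 2) ∂stdGauss := by
  have hb₀ : 0 ≤ b := (abs_nonneg _).trans (hb 0)
  set p := f.derivative with hp
  set q : ℝ → ℝ := fun x => τ ^ 2 / (p.eval x ^ 2 + τ ^ 2)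
  have hq : Integrable q stdGauss := integrable_sq_div_sq_add_sq p hτ
  have hψ_int : Integrable (fun x => ψ (f.eval x)) stdGauss :=
    integrable_comp_of_abs_le f.continuous.measurable hψ hc
  have hψq : Integrable (fun x => ψ (f.eval x) * q x) stdGauss :=
    hq.bdd_mul (c := c) (by fun_prop) (.of_forall fun x => hc _)
  have main_term := abs_integral_comp_eval_mul_derivative_mul_le hΦ hψ hb hc f
    (fun x => hasDerivAt_div_sq_add_sq hτ.ne' (p.hasDerivAt x))
    (fun x => abs_div_sq_add_sq_le (p.eval x) hτ) (integrable_deriv_div_sq_add_sq p hτ)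
  have error_term : |∫ x, ψ (f.eval x) * q x ∂stdGauss| ≤ c * ∫ x, q x ∂stdGauss := by
    rw [← integral_const_mul, ← Real.norm_eq_abs]
    refine norm_integral_le_of_norm_le (hq.const_mul c) (.of_forall fun x => ?_)
    have hqx : 0 ≤ q x := by positivity
    rw [norm_mul, Real.norm_of_nonneg hqx]
    exact mul_le_mul_of_nonneg_right (hc _) hqx
  have hsplit (x : ℝ) : ψ (f.eval x) * (p.eval x * (p.eval x / (p.eval x ^ 2 + τ ^ 2))) =
      ψ (f.eval x) - ψ (f.eval x) * q x := by
    simp only [q]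
    field_simp
    ring
  rw [← hp] at main_term
  simp_rw [hsplit] at main_term
  rw [integral_sub hψ_int hψq] at main_term
  calc |∫ x, ψ (f.eval x) ∂stdGauss|
      ≤ |∫ x, ψ (f.eval x) ∂stdGauss - ∫ x, ψ (f.eval x) * q x ∂stdGauss| +
          |∫ x, ψ (f.eval x) * q x ∂stdGauss| := by
        simpa using abs_add_le (∫ x, ψ (f.eval x) ∂stdGauss - ∫ x, ψ (f.eval x) * q x ∂stdGauss)
          (∫ x, ψ (f.eval x) * q x ∂stdGauss)
    _ ≤ b * (1 / τ * ∫ x, |x| ∂stdGauss + p.natDegree * Real.pi / τ) +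
          c * ∫ x, q x ∂stdGauss := by
        gcongr
        exact main_term.trans (by gcongr; exact integral_abs_deriv_div_sq_add_sq_le p hτ)
    _ = _ := by ring

theorem mul_div_rpow_eq (hb : 0 ≤ b) (hc : 0 < c) (α : ℝ) :
    c * (b / c) ^ α = b ^ α * c ^ (1 - α) := by
  rw [Real.div_rpow hb hc.le, Real.rpow_sub hc, Real.rpow_one]
  ring

theorem nikolskiiBesovBound_of_natDegree_le_one {f : ℝ[X]} (hf : f.natDegree ≤ 1) {s : ℝ}
    (hs : 0 < s) (hfs : s ≤ gradNorm f) :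
    NikolskiiBesovBound stdGauss (fun x => f.eval x) 1 ((∫ x, |x| ∂stdGauss) / s) := by
  intro Φ ψ b c _ _ hΦ hψ hb hc
  obtain ⟨a, ha⟩ : ∃ a, f.derivative = C a :=
    ⟨_, eq_C_of_natDegree_le_zero ((natDegree_derivative_le f).trans (by omega))⟩
  have hsa : s ≤ |a| := by
    simpa only [gradNorm, ha, eval_C, integral_const, probReal_univ, one_smul,
      Real.sqrt_sq_eq_abs] using hfs
  have ha₀ : a ≠ 0 := abs_pos.1 (hs.trans_le hsa)
  have h := abs_integral_comp_eval_mul_derivative_mul_le hΦ hψ hb hc f (k := fun _ => 1 / a)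
    (k' := fun _ => 0) (κ := 1 / s) (fun x => hasDerivAt_const x _)
    (fun _ => by rw [abs_div, abs_one]; gcongr) (integrable_zero _ _ _)
  simp only [ha, eval_C, mul_one_div_cancel ha₀, mul_one, abs_zero, integral_zero, add_zero] at h
  rw [Real.rpow_one, sub_self, Real.rpow_zero]
  exact h.trans_eq (by ring)

/-- The scale `τ` at which the two terms of `abs_integral_comp_eval_le` balance satisfies
`b / τ = c * τ ^ (1 / n)`. -/
theorem exists_nikolskiiBesovBound_of_natDegree_le_succ {n : ℕ} (hn : n ≠ 0) {s : ℝ}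
    (hs : 0 < s) :
    ∃ C : ℝ, 0 < C ∧ ∀ f : ℝ[X], f.natDegree ≤ n + 1 → s ≤ gradNorm f →
      NikolskiiBesovBound stdGauss (fun x => f.eval x) (1 / (n + 1 : ℝ)) C := by
  obtain ⟨A, hA, small_values⟩ := exists_integral_sq_div_sq_add_sq_le_rpow hn hs
  refine ⟨∫ x, |x| ∂stdGauss + n * Real.pi + A, by positivity,
    fun f hf hfs Φ ψ b c hb₀ hc₀ hΦ hψ hb hc => ?_⟩
  have hdeg : f.derivative.natDegree ≤ n := (natDegree_derivative_le f).trans (by omega)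
  obtain ⟨τ, hτ, hdiv, hpow⟩ := exists_pos_div_eq_rpow_and_rpow_eq (div_pos hb₀ hc₀)
    (Nat.cast_pos.2 (Nat.pos_of_ne_zero hn) : (0 : ℝ) < n)
  have hbτ : b / τ = c * (b / c) ^ (1 / (n + 1 : ℝ)) := by
    rw [← hdiv]
    field_simp
  calc |∫ x, ψ (f.eval x) ∂stdGauss|
      ≤ (∫ x, |x| ∂stdGauss + f.derivative.natDegree * Real.pi) * (b / τ) +
          c * ∫ x, τ ^ 2 / (f.derivative.eval x ^ 2 + τ ^ 2) ∂stdGauss :=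
        abs_integral_comp_eval_le hΦ hψ hb hc f hτ
    _ ≤ (∫ x, |x| ∂stdGauss + n * Real.pi) * (b / τ) + c * (A * τ ^ (1 / n : ℝ)) := by
        gcongr
        exact small_values _ hdeg hfs τ hτ
    _ = (∫ x, |x| ∂stdGauss + n * Real.pi + A) * (c * (b / c) ^ (1 / (n + 1 : ℝ))) := by
        rw [hbτ, hpow]
        ring
    _ = _ := by rw [mul_div_rpow_eq hb₀.le hc₀, mul_assoc]

theorem exists_nikolskiiBesovBound {m : ℕ} (hm : 1 ≤ m) {s : ℝ} (hs : 0 < s) :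
    ∃ C : ℝ, 0 < C ∧ ∀ f : ℝ[X], f.natDegree ≤ m → s ≤ gradNorm f →
      NikolskiiBesovBound stdGauss (fun x => f.eval x) (1 / (m : ℝ)) C := by
  obtain ⟨n, rfl⟩ := Nat.exists_eq_add_of_le' hm
  rcases eq_or_ne n 0 with rfl | hn
  · have hE : 0 < ∫ x, |x| ∂stdGauss :=
      integral_pos_of_eval_ne_zero X_ne_zero (fun x => abs_nonneg x) integrable_abs_stdGauss
        fun x => by simp
    refine ⟨(∫ x, |x| ∂stdGauss) / s, by positivity, fun f hf hfs => ?_⟩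
    simpa using nikolskiiBesovBound_of_natDegree_le_one hf hs hfs
  · simpa using exists_nikolskiiBesovBound_of_natDegree_le_succ hn hs

end PolynomialImages

section Coefficients

theorem abs_coeff_sub_le_coeffDist {m k : ℕ} (hk : k ≤ m) (f g : ℝ[X]) :
    |f.coeff k - g.coeff k| ≤ coeffDist m f g :=
  Finset.le_sup' (fun k => |f.coeff k - g.coeff k|) (Finset.mem_range.2 (Nat.lt_succ_of_le hk))

theorem coeffDist_nonneg (m : ℕ) (f g : ℝ[X]) : 0 ≤ coeffDist m f g :=
  (abs_nonneg _).trans (abs_coeff_sub_le_coeffDist m.zero_le f g)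

theorem eq_of_coeffDist_eq_zero {m : ℕ} {f g : ℝ[X]} (hf : f.natDegree ≤ m)
    (hg : g.natDegree ≤ m) (h : coeffDist m f g = 0) : f = g := by
  ext k
  rcases le_or_gt k m with hk | hk
  · exact sub_eq_zero.1 (abs_nonpos_iff.1 (h ▸ abs_coeff_sub_le_coeffDist hk f g))
  · rw [coeff_eq_zero_of_natDegree_lt (hf.trans_lt hk),
      coeff_eq_zero_of_natDegree_lt (hg.trans_lt hk)]

theorem abs_eval_le {p : ℝ[X]} {m : ℕ} (hp : p.natDegree ≤ m) {c : ℝ}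
    (hc : ∀ k ≤ m, |p.coeff k| ≤ c) (x : ℝ) : |p.eval x| ≤ (m + 1) * c * (1 + |x|) ^ m := by
  have hc₀ : 0 ≤ c := (abs_nonneg _).trans (hc 0 m.zero_le)
  rw [eval_eq_sum_range' (Nat.lt_succ_of_le hp)]
  calc |∑ k ∈ Finset.range (m + 1), p.coeff k * x ^ k|
      ≤ ∑ k ∈ Finset.range (m + 1), |p.coeff k * x ^ k| := Finset.abs_sum_le_sum_abs _ _
    _ ≤ ∑ k ∈ Finset.range (m + 1), c * (1 + |x|) ^ m := by
        refine Finset.sum_le_sum fun k hk => ?_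
        have hkm : k ≤ m := Finset.mem_range_succ_iff.1 hk
        rw [abs_mul, abs_pow]
        gcongr
        · exact hc k hkm
        · calc |x| ^ k ≤ (1 + |x|) ^ k := by gcongr; linarith
            _ ≤ (1 + |x|) ^ m := pow_le_pow_right₀ (by linarith [abs_nonneg x]) hkm
    _ = (m + 1) * c * (1 + |x|) ^ m := by
        rw [Finset.sum_const, Finset.card_range, nsmul_eq_mul]
        push_cast
        ring

theorem integral_abs_eval_sub_le {m : ℕ} {f g : ℝ[X]} (hf : f.natDegree ≤ m)
    (hg : g.natDegree ≤ m) :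
    ∫ x, |f.eval x - g.eval x| ∂stdGauss ≤
      ((m + 1) * ∫ x, (1 + |x|) ^ m ∂stdGauss) * coeffDist m f g := by
  rw [mul_right_comm, ← integral_const_mul]
  refine integral_mono ((integrable_eval f).sub (integrable_eval g)).abs
    ((integrable_one_add_abs_pow m).const_mul _) fun x => ?_
  simpa only [eval_sub] using abs_eval_le ((natDegree_sub_le f g).trans (max_le hf hg))
    (fun k hk => by simpa only [coeff_sub] using abs_coeff_sub_le_coeffDist hk f g) x

end Coefficients

end ImageTV

theorem mainTheorem5 (m : ℕ) (hm : 1 ≤ m) :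
    (∀ f : Polynomial ℝ, f.natDegree = m →
      ∃ C : ℝ, 0 < C ∧
        ImageTV.ShiftCondition ImageTV.stdGauss (fun x => f.eval x) (1 / (m : ℝ)) C) ∧
    (∃ C : ℝ → ℝ → ℝ, (∀ s t : ℝ, 0 < s → 0 < t → 0 < C s t) ∧
      ∀ f g : Polynomial ℝ, 1 ≤ f.natDegree → f.natDegree ≤ m →
        1 ≤ g.natDegree → g.natDegree ≤ m →
        ImageTV.imageDist ImageTV.stdGauss (fun x => f.eval x) (fun x => g.eval x) ≤
          C (ImageTV.gradNorm f) (ImageTV.gradNorm g) *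
            ImageTV.coeffDist m f g ^ (1 / ((m : ℝ) + 1))) := by
  choose! C hC_pos hC using fun s (hs : 0 < s) => ImageTV.exists_nikolskiiBesovBound hm hs
  have hm₀ : (0 : ℝ) < m := by exact_mod_cast hm
  refine ⟨fun f hf => ?_, fun s t => (C s + C t) * 2 ^ (1 - 1 / (m : ℝ)) +
    2 * ((m + 1) * ∫ x, (1 + |x|) ^ m ∂ImageTV.stdGauss), fun s t hs ht => ?_,
    fun f g hf hfm hg hgm => ?_⟩
  · have hpos := ImageTV.gradNorm_pos (hm.trans hf.ge)
    have hC₀ := hC_pos _ hpos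
    exact ⟨C (ImageTV.gradNorm f) * 2 ^ (1 - 1 / (m : ℝ)), by positivity,
      (hC _ hpos f hf.le le_rfl).shiftCondition f.continuous.measurable hC₀.le⟩
  · have := hC_pos s hs
    have := hC_pos t ht
    positivity
  · rcases (ImageTV.coeffDist_nonneg m f g).eq_or_lt' with hδ | hδ
    · rw [hδ, ImageTV.eq_of_coeffDist_eq_zero hfm hgm hδ, ImageTV.imageDist_self,
        Real.zero_rpow (by positivity), mul_zero]
    · exact ImageTV.NikolskiiBesovBound.imageDist_le_rpow hm₀
        (hC _ (ImageTV.gradNorm_pos hf) f hfm le_rfl) (hC _ (ImageTV.gradNorm_pos hg) g hgm le_rfl)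
        f.continuous.measurable g.continuous.measurable
        ((ImageTV.integrable_eval f).sub (ImageTV.integrable_eval g)) hδ
        (ImageTV.integral_abs_eval_sub_le hfm hgm)
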